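/- Let $\Theta\subset\mathbb R$ be closed and $\mathbf a:\Theta\to\mathbb C^m$ smooth, with derivative $\mathbf d=\mathrm d\mathbf a/\mathrm d\theta$. For distinct $\theta_1,\dots,\theta_n\in\Theta$ put $\mathbf A(\boldsymbol\theta)=[\mathbf a(\theta_1)\cdots\mathbf a(\theta_n)]$ and $\mathbf D(\boldsymbol\theta)=[\mathbf d(\theta_1)\cdots\mathbf d(\theta_n)]$. For $\mathbf S\in\mathbb C^{n\times T}$ with rows $\mathbf S_i$ let $\gamma_i=\|\mathbf S_i\|_2$, $\boldsymbol\Gamma_{\mathbf S}=\mathrm{diag}(\gamma_1,\dots,\gamma_n)$ and $\|\mathbf S\|_{1,2}=\sum_i\gamma_i$. A pair $(\boldsymbol\theta,\mathbf S)$ of order $n$ ($n$ distinct indexes in $\Theta$ and $\mathbf S\in\mathbb C^{n\times T}$) is irreducible if no row of $\mathbf S$ is zero; pairs are identified up to simultaneous permutation of the indexes and the rows. For data $\mathbf X\in\mathbb C^{m\times T}$ and $\lambda>0$, a CLASS solution is a minimizer of $\frac12\|\mathbf X-\mathbf A(\boldsymbol\theta)\mathbf S\|_F^2+\lambda\|\mathbf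 S\|_{1,2}$ over all irreducible pairs of arbitrary finite order. A noiseless CLASS solution is a minimizer of $\|\mathbf S\|_{1,2}$ over all irreducible pairs of arbitrary finite order with $\mathbf A(\boldsymbol\theta)\mathbf S=\mathbf X$. Let $(\boldsymbol\theta,\mathbf S)$ be true parameters of order $n$, with every $\theta_i$ in the interior of $\Theta$, and let $\mathbf X=\mathbf A(\boldsymbol\theta)\mathbf S$. Suppose that (i) $(\boldsymbol\theta,\mathbf S)$ is CLASS-consistent: it is the unique noiseless CLASS solution for $\mathbf X$; (ii) the case is pure: for all sufficiently small $\lambda>0$ there is a CLASS solution for $(\mathbf X,\lambda)$ of the same order $n$, and the indexes of these solutions stay in a bounded set as $\lambda\to0$ (which is automatic if $\Theta$ is bounded). Write $\mathbf A=\mathbf A(\boldsymbol\theta)$, $\mathbf D=\mathbf D(\boldsymbol\theta)$, $\mathbf d_i=\mathbf d(\theta_i)$, $\mathbf P_A^\perp=\mathbf I-\mathbf A(\mathbf A^H\mathbf A)^{-1}\mathbf A^H$, $\mathbf U=\boldsymbol\Gamma_{\mathbf S}^{-1}\mathbf S$, $\boldsymbol\Xi=\mathbf U\mathbf U^H=[\boldsymbol\xi_1\cdots\boldsymbol\xi_n]$,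 $\mathbf R=\mathrm{Re}[(\mathbf D^H\mathbf P_A^\perp\mathbf D)\odot\boldsymbol\Xi^T]$ with $\odot$ the entrywise product, $\boldsymbol\beta=\boldsymbol\Gamma_{\mathbf S}^{-1}\mathbf R^{-1}\big(\mathrm{Re}[\mathbf d_i^H\mathbf A(\mathbf A^H\mathbf A)^{-1}\boldsymbol\xi_i]\big)_{i=1}^n$, and let $\Delta Q_0$ be the diagonal matrix with the entries of $\boldsymbol\Gamma_{\mathbf S}\boldsymbol\beta$ on its diagonal; the matrices $\mathbf A^H\mathbf A$ and $\mathbf R$ are assumed invertible. Then, for every square root $\boldsymbol\Xi^{1/2}\in\mathbb C^{n\times n}$ of $\boldsymbol\Xi$ in the sense $\boldsymbol\Xi^{1/2}(\boldsymbol\Xi^{1/2})^H=\boldsymbol\Xi$ (in particular the positive semidefinite one), $$\big\|\mathbf a^H(\theta)\big(\mathbf P_A^\perp\mathbf D\,\Delta Q_0-\mathbf A(\mathbf A^H\mathbf A)^{-1}\big)\boldsymbol\Xi^{1/2}\big\|_2\le1\qquad\text{for every }\theta\in\Theta.$$ -/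

import Mathlib

open scoped Matrix ContDiff Topology
open Filter

noncomputable section

namespace CLASS

variable {m n T : ℕ}

/-- `A(θ) = [a(θ₁) … a(θₙ)]`. -/
def steering (a : ℝ → Fin m → ℂ) (θ : Fin n → ℝ) : Matrix (Fin m) (Fin n) ℂ :=
  Matrix.of fun k i => a (θ i) k

/-- The Euclidean norm of a complex vector. -/
def l2norm (v : Fin n → ℂ) : ℝ := ‖WithLp.toLp 2 v‖

/-- `γ_{i,S}`, the Euclidean norm of the `i`-th row. -/
def rowNorm (S : Matrix (Fin n) (Fin T) ℂ) (i : Fin n) : ℝ := l2norm (S i)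

/-- `‖S‖_{1,2}`. -/
def norm12 (S : Matrix (Fin n) (Fin T) ℂ) : ℝ := ∑ i, rowNorm S i

/-- `‖M‖_F²`. -/
def frobSq (M : Matrix (Fin m) (Fin T) ℂ) : ℝ := ∑ k, ∑ t, ‖M k t‖ ^ 2

/-- `Ψ(X, θ, S, lam) = ½‖X - A(θ)S‖_F² + lam ‖S‖_{1,2}`. -/
def cost (a : ℝ → Fin m → ℂ) (X : Matrix (Fin m) (Fin T) ℂ) (lam : ℝ)
    (θ : Fin n → ℝ) (S : Matrix (Fin n) (Fin T) ℂ) : ℝ :=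
  1 / 2 * frobSq (X - steering a θ * S) + lam * norm12 S

/-- `θ` lists the distinct elements of an `n`-element subset of `Θ`, and the pair `(θ, S)` is
irreducible: no row of `S` is zero. -/
def IsIrreducible (Θ : Set ℝ) (θ : Fin n → ℝ) (S : Matrix (Fin n) (Fin T) ℂ) : Prop :=
  Function.Injective θ ∧ (∀ i, θ i ∈ Θ) ∧ ∀ i, S i ≠ 0

/-- `(θ, S)` solves the CLASS optimization for the data `X` and regularization parameter `lam`:
it minimizes the cost over all irreducible pairs, of any order `k`. -/
def IsSolution (a : ℝ → Fin m → ℂ) (Θ : Set ℝ) (X : Matrix (Fin m) (Fin T) ℂ) (lam : ℝ)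
    (θ : Fin n → ℝ) (S : Matrix (Fin n) (Fin T) ℂ) : Prop :=
  IsIrreducible Θ θ S ∧
    ∀ (k : ℕ) (θ' : Fin k → ℝ) (S' : Matrix (Fin k) (Fin T) ℂ),
      IsIrreducible Θ θ' S' → cost a X lam θ S ≤ cost a X lam θ' S'

/-- `(θ, S)` solves the noiseless CLASS optimization for the data `X`: it minimizes `‖S‖_{1,2}`
over all irreducible pairs, of any order `k`, that represent `X` exactly. -/
def IsNoiselessSolution (a : ℝ → Fin m → ℂ) (Θ : Set ℝ) (X : Matrix (Fin m) (Fin T) ℂ)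
    (θ : Fin n → ℝ) (S : Matrix (Fin n) (Fin T) ℂ) : Prop :=
  IsIrreducible Θ θ S ∧ steering a θ * S = X ∧
    ∀ (k : ℕ) (θ' : Fin k → ℝ) (S' : Matrix (Fin k) (Fin T) ℂ),
      IsIrreducible Θ θ' S' → steering a θ' * S' = X → norm12 S ≤ norm12 S'

/-- The parameters `(θ, S)` are CLASS-consistent: for the noiseless data `A(θ)S` that they generate,
`(θ, S)` is the solution of noiseless CLASS, unique up to the order of listing the indexes. -/
def IsConsistent (a : ℝ → Fin m → ℂ) (Θ : Set ℝ)
    (θ : Fin n → ℝ) (S : Matrix (Fin n) (Fin T) ℂ) : Prop :=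
  IsNoiselessSolution a Θ (steering a θ * S) θ S ∧
    ∀ (k : ℕ) (θ' : Fin k → ℝ) (S' : Matrix (Fin k) (Fin T) ℂ),
      IsNoiselessSolution a Θ (steering a θ * S) θ' S' →
        ∃ e : Fin k ≃ Fin n, θ' = θ ∘ e ∧ S' = S.submatrix e id

/-- The case of the true parameters `(θ, S)` of order `n` is pure: for the noiseless data `A(θ)S`
and all sufficiently small `lam > 0`, CLASS has a solution of the same order `n`. The indexes of
these solutions are to stay in a bounded set, which is automatic when `Θ` is bounded. -/
def IsPure (a : ℝ → Fin m → ℂ) (Θ : Set ℝ)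
    (θ : Fin n → ℝ) (S : Matrix (Fin n) (Fin T) ℂ) : Prop :=
  ∃ C : ℝ, ∀ᶠ lam : ℝ in 𝓝[>] 0,
    ∃ (θ' : Fin n → ℝ) (S' : Matrix (Fin n) (Fin T) ℂ),
      IsSolution a Θ (steering a θ * S) lam θ' S' ∧ ∀ i, |θ' i| ≤ C

/-- `D(θ) = [d(θ₁) … d(θₙ)]` with `d = da/dθ`. -/
def derivSteering (a : ℝ → Fin m → ℂ) (θ : Fin n → ℝ) : Matrix (Fin m) (Fin n) ℂ :=
  steering (deriv a) θ

/-- `Γ_S = diag(γ_{1,S}, …, γ_{n,S})`. -/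
def Gam (S : Matrix (Fin n) (Fin T) ℂ) : Matrix (Fin n) (Fin n) ℝ :=
  Matrix.diagonal (rowNorm S)

/-- `U = Γ_S⁻¹ S`, the matrix of normalized rows. -/
def normalized (S : Matrix (Fin n) (Fin T) ℂ) : Matrix (Fin n) (Fin T) ℂ :=
  (Gam S)⁻¹.map Complex.ofReal * S

/-- `Ξ = U Uᴴ`. -/
def Xi (S : Matrix (Fin n) (Fin T) ℂ) : Matrix (Fin n) (Fin n) ℂ :=
  normalized S * (normalized S)ᴴ

/-- `P_A^⊥ = I - A (AᴴA)⁻¹ Aᴴ`. -/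
def projPerp (A : Matrix (Fin m) (Fin n) ℂ) : Matrix (Fin m) (Fin m) ℂ :=
  1 - A * (Aᴴ * A)⁻¹ * Aᴴ

/-- `R = Re[(Dᴴ P_A^⊥ D) ⊙ Ξᵀ]`. -/
def Rmat (a : ℝ → Fin m → ℂ) (θ : Fin n → ℝ) (S : Matrix (Fin n) (Fin T) ℂ) :
    Matrix (Fin n) (Fin n) ℝ :=
  (((derivSteering a θ)ᴴ * projPerp (steering a θ) * derivSteering a θ) ⊙ (Xi S)ᵀ).map Complex.re

/-- The vector with entries `Re(d_iᴴ A (AᴴA)⁻¹ ξ_i)`, where `ξ_i` is the `i`-th column of `Ξ`. -/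
def biasVec (a : ℝ → Fin m → ℂ) (θ : Fin n → ℝ) (S : Matrix (Fin n) (Fin T) ℂ) : Fin n → ℝ :=
  fun i => (star (deriv a (θ i)) ⬝ᵥ
    ((steering a θ * ((steering a θ)ᴴ * steering a θ)⁻¹) *ᵥ (fun j => Xi S j i))).re

/-- `β = Γ_S⁻¹ R⁻¹ Re[d_iᴴ A (AᴴA)⁻¹ ξ_i]_i`. -/
def beta (a : ℝ → Fin m → ℂ) (θ : Fin n → ℝ) (S : Matrix (Fin n) (Fin T) ℂ) : Fin n → ℝ :=
  (Gam S)⁻¹ *ᵥ ((Rmat a θ S)⁻¹ *ᵥ biasVec a θ S)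

/-- `ΔQ₀`, the diagonal matrix of the elements of `Γ_S β`. -/
def deltaQ0 (a : ℝ → Fin m → ℂ) (θ : Fin n → ℝ) (S : Matrix (Fin n) (Fin T) ℂ) :
    Matrix (Fin n) (Fin n) ℂ :=
  Matrix.diagonal fun i => (((Gam S *ᵥ beta a θ S) i : ℝ) : ℂ)

end CLASS

end

noncomputable section

namespace CLASS

variable {m n T : ℕ}

/-! The bound is the limit, as `lam → 0`, of the dual feasibility condition of CLASS. Inserting an
index `ϑ` with a small row into a solution `(θ', S')` cannot lower the cost, so the residual `E = X
- A(θ')S'` satisfies `‖a(ϑ)ᴴ E‖ ≤ lam` for every `ϑ ∈ Θ` (`IsSolution.l2norm_vecMul_le`). Hence `E /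
lam` satisfies the bound with constant 1, and it remains to identify its limit.

Purity and a bound on the amplitudes give compactness; consistency identifies the limit of the
solutions as the true pair (`exists_seq_solutions`). Equality in the dual constraint at the active
indexes gives `A(θ')ᴴ E = lam U'`, which fixes the part of `E / lam` in the range of `A(θ')`. In the
orthogonal complement only the displaced steering vectors remain, through the quotients `q = (θ' -
θ) / lam` (`residual_eq`).

Stationarity in the interior indexes is a real linear system for `q` (`mulVec_eq_of_stationary`).
Its matrix tends to the invertible `R Γ_S`, so `q → β` and `E / lam → -M U`, where `M = P_A^⊥ D ΔQ₀
- A(AᴴA)⁻¹` (`tendsto_residual`). Since `U Uᴴ = Ξ`, the factor `U` may be replaced by any square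
root of `Ξ` without changing the norm. -/

theorem steering_mul_apply (a : ℝ → Fin m → ℂ) (θ : Fin n → ℝ) (S : Matrix (Fin n) (Fin T) ℂ)
    (k : Fin m) (t : Fin T) : (steering a θ * S) k t = ∑ i, a (θ i) k * S i t := by
  simp [Matrix.mul_apply, steering]

/-! ### Norms of vectors, rows and matrices -/

theorem l2norm_nonneg (v : Fin n → ℂ) : 0 ≤ l2norm v := norm_nonneg _

theorem l2norm_add_le (v w : Fin n → ℂ) : l2norm (v + w) ≤ l2norm v + l2norm w := by
  unfold l2norm
  rw [WithLp.toLp_add]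
  exact norm_add_le _ _

theorem l2norm_smul (c : ℝ) (v : Fin n → ℂ) : l2norm (c • v) = |c| * l2norm v := by
  unfold l2norm
  rw [WithLp.toLp_smul, norm_smul, Real.norm_eq_abs]

@[simp]
theorem l2norm_zero : l2norm (0 : Fin n → ℂ) = 0 := by
  simp [l2norm]

theorem l2norm_sq (v : Fin n → ℂ) : l2norm v ^ 2 = ∑ i, ‖v i‖ ^ 2 := by
  unfold l2norm
  rw [EuclideanSpace.norm_sq_eq]

theorem l2norm_pos {v : Fin n → ℂ} (hv : v ≠ 0) : 0 < l2norm v := by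
  unfold l2norm
  rw [norm_pos_iff]
  simpa using hv

theorem continuous_l2norm : Continuous (l2norm : (Fin n → ℂ) → ℝ) :=
  (PiLp.continuous_toLp 2 _).norm

theorem norm_apply_le_l2norm (v : Fin n → ℂ) (i : Fin n) : ‖v i‖ ≤ l2norm v :=
  PiLp.norm_apply_le (WithLp.toLp 2 v) i

theorem rowNorm_nonneg (S : Matrix (Fin n) (Fin T) ℂ) (i : Fin n) : 0 ≤ rowNorm S i :=
  l2norm_nonneg _

theorem norm12_nonneg (S : Matrix (Fin n) (Fin T) ℂ) : 0 ≤ norm12 S :=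
  Finset.sum_nonneg fun _ _ => rowNorm_nonneg _ _

theorem frobSq_nonneg (M : Matrix (Fin m) (Fin T) ℂ) : 0 ≤ frobSq M :=
  Finset.sum_nonneg fun _ _ => Finset.sum_nonneg fun _ _ => by positivity

/-! ### Reduction to irreducible pairs -/

/-- A pair that is not irreducible can be shortened by one index. -/
theorem exists_shorter_of_not_isIrreducible (a : ℝ → Fin m → ℂ) {Θ : Set ℝ}
    {θ : Fin (n + 1) → ℝ} {S : Matrix (Fin (n + 1)) (Fin T) ℂ} (hθ : ∀ i, θ i ∈ Θ)
    (h : ¬ IsIrreducible Θ θ S) :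
    ∃ (θ' : Fin n → ℝ) (S' : Matrix (Fin n) (Fin T) ℂ), (∀ i, θ' i ∈ Θ) ∧
      steering a θ' * S' = steering a θ * S ∧ norm12 S' ≤ norm12 S := by
  by_cases hz : ∃ i, S i = 0
  · obtain ⟨i, hi⟩ := hz
    refine ⟨θ ∘ i.succAbove, S.submatrix i.succAbove id, fun j => hθ _, ?_, ?_⟩
    · ext k t
      rw [steering_mul_apply, steering_mul_apply, Fin.sum_univ_succAbove _ i]
      simp [hi]
    · unfold norm12
      rw [Fin.sum_univ_succAbove _ i]
      exact le_add_of_nonneg_left (rowNorm_nonneg S i)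
  · have hinj : ¬ Function.Injective θ := fun hi =>
      h ⟨hi, hθ, fun i hi => hz ⟨i, hi⟩⟩
    simp only [Function.Injective, not_forall] at hinj
    obtain ⟨j, i, hij, hne⟩ := hinj
    obtain ⟨j', rfl⟩ := Fin.exists_succAbove_eq hne
    -- The row of the duplicate index `i` is added to that of its twin: the product is kept, and the
    -- triangle inequality controls the norm.
    refine ⟨θ ∘ i.succAbove,
      Matrix.of fun l => S (i.succAbove l) + if l = j' then S i else 0, fun j => hθ _, ?_, ?_⟩
    · ext k t
      rw [steering_mul_apply, steering_mul_apply, Fin.sum_univ_succAbove _ i]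
      simp only [Function.comp, Matrix.of_apply, Pi.add_apply, mul_add, Finset.sum_add_distrib]
      rw [add_comm, ← hij]
      congr 1
      rw [Finset.sum_eq_single j']
      · simp
      · intro b _ hb
        simp [hb]
      · simp
    · unfold norm12
      rw [Fin.sum_univ_succAbove _ i, add_comm]
      have : rowNorm S i = ∑ l, if l = j' then rowNorm S i else 0 := by simp
      rw [this, ← Finset.sum_add_distrib]
      refine Finset.sum_le_sum fun l _ => (l2norm_add_le _ _).trans ?_
      refine add_le_add le_rfl ?_
      split_ifs <;> simp [rowNorm]

/-- Every pair can be replaced by an irreducible one with the same product, without increasing the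
norm; the order drops unless the pair was irreducible. -/
theorem exists_isIrreducible (a : ℝ → Fin m → ℂ) {Θ : Set ℝ} :
    ∀ (n : ℕ) (θ : Fin n → ℝ) (S : Matrix (Fin n) (Fin T) ℂ), (∀ i, θ i ∈ Θ) →
    ∃ (k : ℕ) (θ' : Fin k → ℝ) (S' : Matrix (Fin k) (Fin T) ℂ), IsIrreducible Θ θ' S' ∧
      steering a θ' * S' = steering a θ * S ∧ norm12 S' ≤ norm12 S ∧
      (k < n ∨ k = n ∧ IsIrreducible Θ θ S) := by
  intro n
  induction n with
  | zero =>
    intro θ S hθ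
    have h : IsIrreducible Θ θ S :=
      ⟨fun i => i.elim0, fun i => i.elim0, fun i => i.elim0⟩
    exact ⟨0, θ, S, h, rfl, le_rfl, Or.inr ⟨rfl, h⟩⟩
  | succ n ih =>
    intro θ S hθ
    by_cases h : IsIrreducible Θ θ S
    · exact ⟨n + 1, θ, S, h, rfl, le_rfl, Or.inr ⟨rfl, h⟩⟩
    · obtain ⟨θ₁, S₁, hθ₁, hp₁, hn₁⟩ := exists_shorter_of_not_isIrreducible a hθ h
      obtain ⟨k, θ₂, S₂, hirr, hp₂, hn₂, hk⟩ := ih θ₁ S₁ hθ₁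
      refine ⟨k, θ₂, S₂, hirr, hp₂.trans hp₁, hn₂.trans hn₁, Or.inl ?_⟩
      rcases hk with hk | ⟨hk, -⟩ <;> omega

/-! ### Optimality conditions -/

/-- Reduction to an irreducible pair keeps the fit and does not raise the penalty. Variations may
therefore repeat an index or contain zero rows. -/
theorem IsSolution.cost_le {a : ℝ → Fin m → ℂ} {Θ : Set ℝ} {X : Matrix (Fin m) (Fin T) ℂ}
    {lam : ℝ} (hlam : 0 ≤ lam) {θ : Fin n → ℝ} {S : Matrix (Fin n) (Fin T) ℂ}
    (h : IsSolution a Θ X lam θ S) {k : ℕ} (θ' : Fin k → ℝ) (S' : Matrix (Fin k) (Fin T) ℂ)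
    (hθ' : ∀ i, θ' i ∈ Θ) : cost a X lam θ S ≤ cost a X lam θ' S' := by
  obtain ⟨l, θ₂, S₂, hirr, hp, hn, -⟩ := exists_isIrreducible a k θ' S' hθ'
  refine (h.2 l θ₂ S₂ hirr).trans ?_
  unfold cost
  rw [hp]
  gcongr

/-- The real inner product that induces `frobSq`. -/
def reInner (M N : Matrix (Fin m) (Fin T) ℂ) : ℝ := ∑ k, ∑ t, (star (M k t) * N k t).re

theorem frobSq_sub_smul (M N : Matrix (Fin m) (Fin T) ℂ) (t : ℝ) :
    frobSq (M - t • N) = frobSq M - 2 * t * reInner N M + t ^ 2 * frobSq N := by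
  unfold frobSq reInner
  simp only [Finset.mul_sum, ← Finset.sum_sub_distrib, ← Finset.sum_add_distrib]
  refine Finset.sum_congr rfl fun k _ => Finset.sum_congr rfl fun s _ => ?_
  simp only [Complex.sq_norm, Complex.normSq_apply, Matrix.sub_apply, Matrix.smul_apply,
    Complex.sub_re, Complex.sub_im, Complex.mul_re, Complex.star_def, Complex.conj_re,
    Complex.conj_im, Complex.smul_re, Complex.smul_im, smul_eq_mul]
  ring

/-- Divide by `t` and let `t → 0`. This extracts first-order conditions from one-sided comparisons
of costs, without differentiating the norm. -/
theorem nonneg_of_forall_quadratic_nonneg {c d : ℝ}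
    (h : ∀ t : ℝ, 0 < t → t ≤ 1 → 0 ≤ t * c + t ^ 2 * d) : 0 ≤ c := by
  have h1 : ∀ᶠ t : ℝ in 𝓝[>] 0, 0 ≤ c + t * d := by
    filter_upwards [Ioc_mem_nhdsGT (zero_lt_one' ℝ)] with t ht
    have := h t ht.1 ht.2
    have h2 : t * c + t ^ 2 * d = t * (c + t * d) := by ring
    rw [h2] at this
    exact nonneg_of_mul_nonneg_right this ht.1
  have h2 : Tendsto (fun t : ℝ => c + t * d) (𝓝[>] 0) (𝓝 (c + 0 * d)) :=
    ((continuous_const.add (continuous_id.mul continuous_const)).tendsto 0).mono_left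
      nhdsWithin_le_nhds
  simpa using ge_of_tendsto h2 h1

theorem reInner_vecMulVec (x : Fin m → ℂ) (v : Fin T → ℂ) (M : Matrix (Fin m) (Fin T) ℂ) :
    reInner (Matrix.vecMulVec x v) M = (star v ⬝ᵥ (star x ᵥ* M)).re := by
  unfold reInner
  rw [Finset.sum_comm]
  simp only [dotProduct, Matrix.vecMul, Complex.re_sum, Finset.mul_sum]
  refine Finset.sum_congr rfl fun t _ => Finset.sum_congr rfl fun k _ => ?_
  congr 1
  simp only [Matrix.vecMulVec_apply, star_mul', Pi.star_apply]
  ring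

theorem re_star_dotProduct_self (v : Fin n → ℂ) : (star v ⬝ᵥ v).re = l2norm v ^ 2 := by
  rw [l2norm_sq]
  simp only [dotProduct, Complex.re_sum]
  refine Finset.sum_congr rfl fun i _ => ?_
  simp [Complex.sq_norm, Complex.normSq_apply]

theorem norm12_smul (c : ℝ) (S : Matrix (Fin n) (Fin T) ℂ) : norm12 (c • S) = |c| * norm12 S := by
  unfold norm12
  rw [Finset.mul_sum]
  exact Finset.sum_congr rfl fun i _ => l2norm_smul c (S i)

/-- The dual constraint, tested against a row `v`. -/
theorem IsSolution.reInner_le {a : ℝ → Fin m → ℂ} {Θ : Set ℝ} {X : Matrix (Fin m) (Fin T) ℂ}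
    {lam : ℝ} (hlam : 0 ≤ lam) {θ : Fin n → ℝ} {S : Matrix (Fin n) (Fin T) ℂ}
    (h : IsSolution a Θ X lam θ S) {ϑ : ℝ} (hϑ : ϑ ∈ Θ) (v : Fin T → ℂ) :
    reInner (Matrix.vecMulVec (a ϑ) v) (X - steering a θ * S) ≤ lam * l2norm v := by
  rw [← sub_nonneg]
  refine nonneg_of_forall_quadratic_nonneg
    (d := 1 / 2 * frobSq (Matrix.vecMulVec (a ϑ) v)) fun t ht _ => ?_
  -- The competitor gains the index `ϑ` with row `t • v`. Nothing prevents `ϑ` from being one of the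
  -- `θ i` already.
  obtain ⟨S', hzero, hsucc⟩ : ∃ S' : Matrix (Fin (n + 1)) (Fin T) ℂ,
      S' 0 = t • v ∧ ∀ i : Fin n, S' i.succ = S i :=
    ⟨Matrix.of (Matrix.vecCons (t • v) S), rfl, fun _ => rfl⟩
  have hS : X - steering a (Matrix.vecCons ϑ θ) * S' =
      (X - steering a θ * S) - t • Matrix.vecMulVec (a ϑ) v := by
    rw [sub_sub]
    congr 1
    ext k s
    rw [Matrix.add_apply, steering_mul_apply, steering_mul_apply, Fin.sum_univ_succ, hzero]
    simp only [hsucc, Matrix.smul_apply, Matrix.vecMulVec_apply, Matrix.cons_val_zero,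
      Matrix.cons_val_succ, Pi.smul_apply, Complex.real_smul]
    ring
  have hN : norm12 S' = t * l2norm v + norm12 S := by
    unfold norm12 rowNorm
    rw [Fin.sum_univ_succ, hzero, l2norm_smul, abs_of_pos ht]
    simp only [hsucc]
  have key := h.cost_le hlam (Matrix.vecCons ϑ θ) S' (Fin.cases hϑ h.1.2.1)
  unfold cost at key
  rw [hS, hN, frobSq_sub_smul] at key
  linarith

/-- Testing with `v` equal to the vector itself gives `‖v‖² ≤ lam ‖v‖`. -/
theorem IsSolution.l2norm_vecMul_le {a : ℝ → Fin m → ℂ} {Θ : Set ℝ}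
    {X : Matrix (Fin m) (Fin T) ℂ} {lam : ℝ} (hlam : 0 ≤ lam) {θ : Fin n → ℝ}
    {S : Matrix (Fin n) (Fin T) ℂ} (h : IsSolution a Θ X lam θ S) {ϑ : ℝ} (hϑ : ϑ ∈ Θ) :
    l2norm (star (a ϑ) ᵥ* (X - steering a θ * S)) ≤ lam := by
  have h1 := h.reInner_le hlam hϑ (star (a ϑ) ᵥ* (X - steering a θ * S))
  rw [reInner_vecMulVec, re_star_dotProduct_self] at h1
  rcases (l2norm_nonneg (star (a ϑ) ᵥ* (X - steering a θ * S))).eq_or_lt with h0 | h0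
  · rw [← h0]; exact hlam
  · rw [sq] at h1
    exact le_of_mul_le_mul_right h1 h0

theorem steering_mul_eq_sum (a : ℝ → Fin m → ℂ) (θ : Fin n → ℝ) (S : Matrix (Fin n) (Fin T) ℂ) :
    steering a θ * S = ∑ i, Matrix.vecMulVec (a (θ i)) (S i) := by
  ext k t
  rw [steering_mul_apply, Matrix.sum_apply]
  rfl

theorem reInner_sum_left {ι : Type*} (s : Finset ι) (M : ι → Matrix (Fin m) (Fin T) ℂ)
    (N : Matrix (Fin m) (Fin T) ℂ) : reInner (∑ i ∈ s, M i) N = ∑ i ∈ s, reInner (M i) N := by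
  unfold reInner
  simp only [Matrix.sum_apply, star_sum, Finset.sum_mul, Complex.re_sum]
  rw [Finset.sum_comm]
  simp_rw [Finset.sum_comm (s := s)]
  rw [Finset.sum_comm]

/-- Shrinking all amplitudes by the factor `1 - t` cannot lower the cost. With the dual constraint
this forces equality at each active index. -/
theorem IsSolution.norm12_le_reInner {a : ℝ → Fin m → ℂ} {Θ : Set ℝ}
    {X : Matrix (Fin m) (Fin T) ℂ} {lam : ℝ} (hlam : 0 ≤ lam) {θ : Fin n → ℝ}
    {S : Matrix (Fin n) (Fin T) ℂ} (h : IsSolution a Θ X lam θ S) :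
    lam * norm12 S ≤ reInner (steering a θ * S) (X - steering a θ * S) := by
  rw [← sub_nonneg]
  refine nonneg_of_forall_quadratic_nonneg
    (d := 1 / 2 * frobSq (steering a θ * S)) fun t ht ht1 => ?_
  have key := h.cost_le hlam θ ((1 - t) • S) h.1.2.1
  have hS : X - steering a θ * ((1 - t) • S) =
      (X - steering a θ * S) - (-t) • (steering a θ * S) := by
    rw [Matrix.mul_smul, sub_smul, one_smul, neg_smul]
    abel
  unfold cost at key
  rw [hS, norm12_smul, abs_of_nonneg (by linarith), frobSq_sub_smul] at key
  linarith

theorem normalized_apply {S : Matrix (Fin n) (Fin T) ℂ} (hS : ∀ i, S i ≠ 0) (i : Fin n)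
    (t : Fin T) : normalized S i t = ((rowNorm S i)⁻¹ : ℝ) * S i t := by
  have : (Gam S)⁻¹ = Matrix.diagonal fun i => (rowNorm S i)⁻¹ := by
    refine Matrix.inv_eq_right_inv ?_
    rw [Gam, Matrix.diagonal_mul_diagonal, ← Matrix.diagonal_one]
    congr 1
    funext i
    exact mul_inv_cancel₀ (l2norm_pos (hS i)).ne'
  rw [normalized, this, Matrix.diagonal_map (by simp), Matrix.diagonal_mul]

/-- The equality case of Cauchy–Schwarz: for `c = lam / ‖v‖`, expanding `‖w - c v‖²` gives at most
`lam² - 2 lam² + lam² = 0`. -/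
theorem eq_smul_of_re_dotProduct {v w : Fin n → ℂ} {lam : ℝ} (hv : v ≠ 0)
    (hw : l2norm w ≤ lam) (h : lam * l2norm v ≤ (star v ⬝ᵥ w).re) :
    w = (lam * (l2norm v)⁻¹) • v := by
  have hγ := l2norm_pos hv
  have h0 := (l2norm_nonneg w).trans hw
  set c : ℝ := lam * (l2norm v)⁻¹ with hc
  have hcv : c * l2norm v = lam := by rw [hc]; field_simp
  have hexp : l2norm (w - c • v) ^ 2 =
      l2norm w ^ 2 - 2 * c * (star v ⬝ᵥ w).re + c ^ 2 * l2norm v ^ 2 := by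
    simp only [l2norm_sq, dotProduct, Complex.re_sum, Finset.mul_sum, ← Finset.sum_sub_distrib,
      ← Finset.sum_add_distrib]
    refine Finset.sum_congr rfl fun i _ => ?_
    simp only [Complex.sq_norm, Complex.normSq_apply, Pi.sub_apply, Pi.smul_apply, Pi.star_apply,
      Complex.sub_re, Complex.sub_im, Complex.mul_re, Complex.star_def, Complex.conj_re,
      Complex.conj_im, Complex.smul_re, Complex.smul_im, smul_eq_mul]
    ring
  have hle : l2norm (w - c • v) ^ 2 ≤ 0 := by
    have h1 : l2norm w ^ 2 ≤ lam ^ 2 := pow_le_pow_left₀ (l2norm_nonneg w) hw 2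
    have hc0 : 0 ≤ c := by positivity
    have h2 : c * (lam * l2norm v) ≤ c * (star v ⬝ᵥ w).re := mul_le_mul_of_nonneg_left h hc0
    have h3 : c * (lam * l2norm v) = lam ^ 2 := by rw [mul_left_comm, hcv, sq]
    have h4 : c ^ 2 * l2norm v ^ 2 = lam ^ 2 := by rw [← mul_pow, hcv]
    rw [hexp, h4]
    linarith
  by_contra hne
  exact absurd hle (not_le.2 (pow_pos (l2norm_pos (sub_ne_zero.2 hne)) 2))

/-- Stationarity in the amplitudes. -/
theorem IsSolution.conjTranspose_mul_residual {a : ℝ → Fin m → ℂ} {Θ : Set ℝ}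
    {X : Matrix (Fin m) (Fin T) ℂ} {lam : ℝ} (hlam : 0 ≤ lam) {θ : Fin n → ℝ}
    {S : Matrix (Fin n) (Fin T) ℂ} (h : IsSolution a Θ X lam θ S) :
    (steering a θ)ᴴ * (X - steering a θ * S) = lam • normalized S := by
  have hi : ∀ i ∈ Finset.univ, reInner (Matrix.vecMulVec (a (θ i)) (S i)) (X - steering a θ * S) ≤
      lam * l2norm (S i) := fun i _ => h.reInner_le hlam (h.1.2.1 i) (S i)
  have hsum := h.norm12_le_reInner hlam
  conv_rhs at hsum => arg 1; rw [steering_mul_eq_sum]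
  rw [reInner_sum_left, norm12, Finset.mul_sum] at hsum
  -- The termwise upper bounds and the reverse bound on their sum leave equality in every term.
  have heq := (Finset.sum_eq_sum_iff_of_le hi).1 (le_antisymm (Finset.sum_le_sum hi) hsum)
  ext i t
  have h1 := heq i (Finset.mem_univ i)
  rw [reInner_vecMulVec] at h1
  have h2 := congrFun (eq_smul_of_re_dotProduct (h.1.2.2 i)
    (h.l2norm_vecMul_le hlam (h.1.2.1 i)) h1.ge) t
  rw [Matrix.smul_apply, normalized_apply h.1.2.2]
  have h3 : ((steering a θ)ᴴ * (X - steering a θ * S)) i t =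
      (star (a (θ i)) ᵥ* (X - steering a θ * S)) t := rfl
  rw [h3, h2]
  simp [rowNorm, mul_assoc]

/-- Stationarity in an index that is interior to `Θ`. -/
theorem IsSolution.re_deriv_eq_zero {a : ℝ → Fin m → ℂ} {Θ : Set ℝ}
    {X : Matrix (Fin m) (Fin T) ℂ} {lam : ℝ} (hlam : 0 ≤ lam) {θ : Fin n → ℝ}
    {S : Matrix (Fin n) (Fin T) ℂ} (h : IsSolution a Θ X lam θ S) {i : Fin n}
    (hi : θ i ∈ interior Θ) (hd : DifferentiableAt ℝ a (θ i)) :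
    reInner (Matrix.vecMulVec (deriv a (θ i)) (S i)) (X - steering a θ * S) = 0 := by
  set R := X - steering a θ * S with hR
  let f : ℝ → ℝ := fun s => frobSq (R - Matrix.vecMulVec (a s - a (θ i)) (S i))
  have hmin : IsLocalMin f (θ i) := by
    filter_upwards [mem_interior_iff_mem_nhds.1 hi] with s hs
    -- Only one index moves and the amplitudes stay fixed, so the penalty cancels and the smooth
    -- misfit alone has a local minimum.
    have key := h.cost_le hlam (Function.update θ i s) S (fun j => by
      by_cases hj : j = i
      · subst hj; simpa using hs
      · simpa [hj] using h.1.2.1 j)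
    have hres : X - steering a (Function.update θ i s) * S =
        R - Matrix.vecMulVec (a s - a (θ i)) (S i) := by
      rw [hR, sub_sub]
      congr 1
      rw [steering_mul_eq_sum, steering_mul_eq_sum,
        ← Finset.add_sum_erase _ _ (Finset.mem_univ i),
        ← Finset.add_sum_erase (a := i) _ (fun j => Matrix.vecMulVec (a (θ j)) (S j))
          (Finset.mem_univ i)]
      have he : ∑ x ∈ Finset.univ.erase i, Matrix.vecMulVec (a (Function.update θ i s x)) (S x) =
          ∑ x ∈ Finset.univ.erase i, Matrix.vecMulVec (a (θ x)) (S x) :=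
        Finset.sum_congr rfl fun j hj => by
          rw [Function.update_of_ne (Finset.ne_of_mem_erase hj)]
      rw [he, Function.update_self, Matrix.sub_vecMulVec]
      abel
    unfold cost at key
    rw [hres, ← hR] at key
    have h0 : f (θ i) = frobSq R := by simp [f]
    rw [h0]
    change frobSq R ≤ frobSq (R - Matrix.vecMulVec (a s - a (θ i)) (S i))
    linarith
  have hent : ∀ k t, HasDerivAt (fun s => ‖R k t - (a s k - a (θ i) k) * S i t‖ ^ 2)
      (2 * inner ℝ (R k t) (-(deriv a (θ i) k * S i t))) (θ i) := by
    intro k t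
    have h1 : HasDerivAt (fun s => a s k) (deriv a (θ i) k) (θ i) :=
      hasDerivAt_pi.1 hd.hasDerivAt k
    have h2 := (((h1.sub_const (a (θ i) k)).mul_const (S i t)).const_sub (R k t)).norm_sq
    simpa using h2
  have hf : HasDerivAt f (∑ k, ∑ t, 2 * inner ℝ (R k t) (-(deriv a (θ i) k * S i t))) (θ i) :=
    HasDerivAt.fun_sum fun k _ => HasDerivAt.fun_sum fun t _ => hent k t
  have hz := hmin.hasDerivAt_eq_zero hf
  have : ∑ k, ∑ t, 2 * inner ℝ (R k t) (-(deriv a (θ i) k * S i t)) =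
      -2 * reInner (Matrix.vecMulVec (deriv a (θ i)) (S i)) R := by
    unfold reInner
    simp only [Finset.mul_sum]
    refine Finset.sum_congr rfl fun k _ => Finset.sum_congr rfl fun t _ => ?_
    rw [inner_neg_right, Complex.inner, Matrix.vecMulVec_apply]
    generalize deriv a (θ i) k * S i t = z
    simp only [Complex.mul_re, Complex.star_def, Complex.conj_re, Complex.conj_im]
    ring
  rw [this] at hz
  linarith

/-! ### Convergence of solutions -/

theorem steering_comp_mul_submatrix (a : ℝ → Fin m → ℂ) (θ : Fin n → ℝ)
    (S : Matrix (Fin n) (Fin T) ℂ) {k : ℕ} (e : Fin k ≃ Fin n) :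
    steering a (θ ∘ e) * S.submatrix e id = steering a θ * S := by
  ext k t
  rw [steering_mul_apply, steering_mul_apply]
  exact e.sum_comp fun i => a (θ i) k * S i t

theorem norm12_submatrix (S : Matrix (Fin n) (Fin T) ℂ) {k : ℕ} (e : Fin k ≃ Fin n) :
    norm12 (S.submatrix e id) = norm12 S :=
  e.sum_comp fun i => rowNorm S i

theorem IsSolution.permute {a : ℝ → Fin m → ℂ} {Θ : Set ℝ} {X : Matrix (Fin m) (Fin T) ℂ}
    {lam : ℝ} {θ : Fin n → ℝ} {S : Matrix (Fin n) (Fin T) ℂ} (h : IsSolution a Θ X lam θ S)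
    (e : Fin n ≃ Fin n) : IsSolution a Θ X lam (θ ∘ e) (S.submatrix e id) := by
  refine ⟨⟨h.1.1.comp e.injective, fun i => h.1.2.1 _, fun i => h.1.2.2 _⟩, ?_⟩
  intro k θ' S' h'
  have := h.2 k θ' S' h'
  unfold cost at this ⊢
  rwa [steering_comp_mul_submatrix, norm12_submatrix]

theorem continuous_norm12 : Continuous (norm12 : Matrix (Fin n) (Fin T) ℂ → ℝ) :=
  continuous_finsetSum _ fun i _ => continuous_l2norm.comp (continuous_apply i)

theorem continuous_frobSq : Continuous (frobSq : Matrix (Fin m) (Fin T) ℂ → ℝ) :=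
  continuous_finsetSum _ fun k _ => continuous_finsetSum _ fun t _ =>
    ((continuous_id.matrix_elem k t).norm).pow 2

theorem frobSq_eq_zero {M : Matrix (Fin m) (Fin T) ℂ} (h : frobSq M = 0) : M = 0 := by
  ext k t
  unfold frobSq at h
  rw [Finset.sum_eq_zero_iff_of_nonneg
    (fun _ _ => Finset.sum_nonneg fun _ _ => by positivity)] at h
  have h1 := h k (Finset.mem_univ k)
  rw [Finset.sum_eq_zero_iff_of_nonneg (fun _ _ => by positivity)] at h1
  simpa using h1 t (Finset.mem_univ t)

theorem norm_apply_le_norm12 (S : Matrix (Fin n) (Fin T) ℂ) (i : Fin n) (t : Fin T) :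
    ‖S i t‖ ≤ norm12 S :=
  (norm_apply_le_l2norm (S i) t).trans
    (Finset.single_le_sum (f := rowNorm S) (fun i _ => rowNorm_nonneg S i) (Finset.mem_univ i))

theorem isCompact_setOf_norm_le (c : ℝ) :
    IsCompact {S : Matrix (Fin n) (Fin T) ℂ | ∀ i t, ‖S i t‖ ≤ c} := by
  have := isCompact_univ_pi fun _ : Fin n => isCompact_univ_pi fun _ : Fin T =>
    isCompact_closedBall (0 : ℂ) c
  refine this.of_isClosed_subset ?_ fun S hS i _ t _ => mem_closedBall_zero_iff.2 (hS i t)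
  simp only [Set.ofPred_forall]
  exact isClosed_iInter fun i => isClosed_iInter fun t =>
    isClosed_le (continuous_id.matrix_elem i t).norm continuous_const

theorem tendsto_steering {ι : Type*} {l : Filter ι} {a : ℝ → Fin m → ℂ} {θs : ι → Fin n → ℝ}
    {θ : Fin n → ℝ} (h : ∀ i, Tendsto (fun k => a (θs k i)) l (𝓝 (a (θ i)))) :
    Tendsto (fun k => steering a (θs k)) l (𝓝 (steering a θ)) :=
  tendsto_pi_nhds.2 fun r => tendsto_pi_nhds.2 fun i => (tendsto_pi_nhds.1 (h i)) r

theorem tendsto_mul {ι : Type*} {l : Filter ι} {p q r : ℕ} {M : ι → Matrix (Fin p) (Fin q) ℂ}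
    {N : ι → Matrix (Fin q) (Fin r) ℂ} {M₀ : Matrix (Fin p) (Fin q) ℂ}
    {N₀ : Matrix (Fin q) (Fin r) ℂ} (hM : Tendsto M l (𝓝 M₀)) (hN : Tendsto N l (𝓝 N₀)) :
    Tendsto (fun k => M k * N k) l (𝓝 (M₀ * N₀)) :=
  tendsto_pi_nhds.2 fun i => tendsto_pi_nhds.2 fun j => by
    simp only [Matrix.mul_apply]
    exact tendsto_finsetSum _ fun s _ => (tendsto_pi_nhds.1 (tendsto_pi_nhds.1 hM i) s).mul
      (tendsto_pi_nhds.1 (tendsto_pi_nhds.1 hN s) j)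

/-- Along the path of solutions, the cost at the true parameters bounds the residual and the
norm. -/
theorem IsSolution.bounds {a : ℝ → Fin m → ℂ} {Θ : Set ℝ} {lam : ℝ} (hlam : 0 < lam)
    {θ θ' : Fin n → ℝ} {S S' : Matrix (Fin n) (Fin T) ℂ} (hirr : IsIrreducible Θ θ S)
    (h : IsSolution a Θ (steering a θ * S) lam θ' S') :
    norm12 S' ≤ norm12 S ∧
      frobSq (steering a θ * S - steering a θ' * S') ≤ 2 * lam * norm12 S := by
  have key := h.2 n θ S hirr
  unfold cost at key
  rw [sub_self] at key
  have h0 : frobSq (0 : Matrix (Fin m) (Fin T) ℂ) = 0 := by simp [frobSq]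
  rw [h0] at key
  have h1 := frobSq_nonneg (steering a θ * S - steering a θ' * S')
  have h2 := mul_nonneg hlam.le (norm12_nonneg S')
  exact ⟨le_of_mul_le_mul_left (by linarith) hlam, by linarith⟩

/-- In a pure consistent case there are solutions of the same order, for regularization parameters
decreasing to zero, that converge to the true parameters. -/
theorem exists_seq_solutions {a : ℝ → Fin m → ℂ} {Θ : Set ℝ} (hΘ : IsClosed Θ)
    (ha : ContinuousOn a Θ) {θ : Fin n → ℝ} {S : Matrix (Fin n) (Fin T) ℂ}
    (hcons : IsConsistent a Θ θ S) (hpure : IsPure a Θ θ S) :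
    ∃ (lam : ℕ → ℝ) (θs : ℕ → Fin n → ℝ) (Ss : ℕ → Matrix (Fin n) (Fin T) ℂ),
      (∀ k, 0 < lam k) ∧ (∀ k, IsSolution a Θ (steering a θ * S) (lam k) (θs k) (Ss k)) ∧
      Tendsto θs atTop (𝓝 θ) ∧ Tendsto Ss atTop (𝓝 S) := by
  obtain ⟨C, hC⟩ := hpure
  have hirr := hcons.1.1
  obtain ⟨lam, hlam0, hlam⟩ := exists_seq_forall_of_frequently
    (hC.and self_mem_nhdsWithin).frequently
  choose θs Ss hsol hbd using fun k => (hlam k).1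
  have hpos : ∀ k, 0 < lam k := fun k => (hlam k).2
  have hlim : Tendsto lam atTop (𝓝 0) := hlam0.mono_right nhdsWithin_le_nhds
  have hK : IsCompact ((Set.univ.pi fun _ : Fin n => Metric.closedBall (0 : ℝ) C ∩ Θ) ×ˢ
      {M : Matrix (Fin n) (Fin T) ℂ | ∀ i t, ‖M i t‖ ≤ norm12 S}) :=
    (isCompact_univ_pi fun _ => (isCompact_closedBall 0 C).inter_right hΘ).prod
      (isCompact_setOf_norm_le _)
  have hmem : ∀ k, (θs k, Ss k) ∈ (Set.univ.pi fun _ : Fin n => Metric.closedBall (0 : ℝ) C ∩ Θ) ×ˢ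
      {M : Matrix (Fin n) (Fin T) ℂ | ∀ i t, ‖M i t‖ ≤ norm12 S} := fun k =>
    ⟨fun i _ => ⟨by simpa using hbd k i, (hsol k).1.2.1 i⟩, fun i t =>
      (norm_apply_le_norm12 _ i t).trans ((hsol k).bounds (hpos k) hirr).1⟩
  have : FirstCountableTopology (Matrix (Fin n) (Fin T) ℂ) :=
    inferInstanceAs (FirstCountableTopology (Fin n → Fin T → ℂ))
  obtain ⟨⟨θ₀, S₀⟩, h₀, φ, hφ, hconv⟩ := hK.tendsto_subseq hmem
  have hθ : Tendsto (fun k => θs (φ k)) atTop (𝓝 θ₀) := (continuous_fst.tendsto _).comp hconv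
  have hS : Tendsto (fun k => Ss (φ k)) atTop (𝓝 S₀) := (continuous_snd.tendsto _).comp hconv
  have hθ₀ : ∀ i, θ₀ i ∈ Θ := fun i => (h₀.1 i trivial).2
  have hA : Tendsto (fun k => steering a (θs (φ k))) atTop (𝓝 (steering a θ₀)) :=
    tendsto_steering fun i => (ha (θ₀ i) (hθ₀ i)).tendsto.comp
      (tendsto_nhdsWithin_iff.2 ⟨tendsto_pi_nhds.1 hθ i,
        Eventually.of_forall fun k => (hsol (φ k)).1.2.1 i⟩)
  have hn : norm12 S₀ ≤ norm12 S :=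
    le_of_tendsto ((continuous_norm12.tendsto _).comp hS)
      (Eventually.of_forall fun k => ((hsol (φ k)).bounds (hpos _) hirr).1)
  have hprod : steering a θ₀ * S₀ = steering a θ * S := by
    have h1 : Tendsto (fun k => frobSq (steering a θ * S - steering a (θs (φ k)) * Ss (φ k))) atTop
        (𝓝 (frobSq (steering a θ * S - steering a θ₀ * S₀))) :=
      (continuous_frobSq.tendsto _).comp (tendsto_const_nhds.sub (tendsto_mul hA hS))
    have h2 : Tendsto (fun k => 2 * lam (φ k) * norm12 S) atTop (𝓝 (2 * 0 * norm12 S)) :=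
      ((hlim.comp hφ.tendsto_atTop).const_mul 2).mul_const _
    have h3 := le_of_tendsto_of_tendsto' h1 h2 fun k => ((hsol (φ k)).bounds (hpos _) hirr).2
    have h4 := frobSq_eq_zero (le_antisymm (by simpa using h3) (frobSq_nonneg _))
    exact (sub_eq_zero.1 h4).symm
  obtain ⟨k, θ₁, S₁, hirr₁, hp₁, hn₁, hk⟩ := exists_isIrreducible a n θ₀ S₀ hθ₀
  have hmin : ∀ {l : ℕ} {θ' : Fin l → ℝ} {S' : Matrix (Fin l) (Fin T) ℂ}, IsIrreducible Θ θ' S' →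
      steering a θ' * S' = steering a θ * S → norm12 S' ≤ norm12 S →
      IsNoiselessSolution a Θ (steering a θ * S) θ' S' := fun h1 h2 h3 =>
    ⟨h1, h2, fun l θ₂ S₂ h4 h5 => h3.trans (hcons.1.2.2 l θ₂ S₂ h4 h5)⟩
  -- If indexes merged or a row vanished in the limit, reduction would yield a noiseless solution of
  -- order below `n`, against uniqueness.
  have hirr₀ : IsIrreducible Θ θ₀ S₀ := by
    rcases hk with hk | hk
    · obtain ⟨e, -⟩ := hcons.2 k θ₁ S₁ (hmin hirr₁ (hp₁.trans hprod) (hn₁.trans hn))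
      exact absurd (by simpa using Fintype.card_congr e) hk.ne
    · exact hk.2
  obtain ⟨e, rfl, rfl⟩ := hcons.2 n θ₀ S₀ (hmin hirr₀ hprod hn)
  -- The limit is the true pair up to the order of its indexes; relisting the whole sequence by
  -- `e.symm` removes the permutation.
  refine ⟨lam ∘ φ, fun k => θs (φ k) ∘ e.symm, fun k => (Ss (φ k)).submatrix e.symm id,
    fun k => hpos _, fun k => (hsol _).permute _, ?_, ?_⟩
  · refine tendsto_pi_nhds.2 fun i => ?_
    simpa using tendsto_pi_nhds.1 hθ (e.symm i)
  · refine tendsto_pi_nhds.2 fun i => ?_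
    have := tendsto_pi_nhds.1 hS (e.symm i)
    have hi : S.submatrix e id (e.symm i) = S i := by
      funext t
      simp
    rw [hi] at this
    exact this

/-! ### First-order expansion of the residual -/

theorem projPerp_mul_self {A : Matrix (Fin m) (Fin n) ℂ} (hA : IsUnit (Aᴴ * A).det) :
    projPerp A * A = 0 := by
  rw [projPerp, Matrix.sub_mul, Matrix.one_mul, Matrix.mul_assoc, Matrix.mul_assoc,
    Matrix.nonsing_inv_mul _ hA, Matrix.mul_one, sub_self]

/-- The residual is split by the projection onto the range of `A'`. The part in the range is read
off from `hU`. The complementary projection kills `A' * S'` and leaves of `A * S` only the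
contribution of `A - A'`, so `S'` drops out. -/
theorem residual_eq {A A' Q : Matrix (Fin m) (Fin n) ℂ} {S S' U : Matrix (Fin n) (Fin T) ℂ}
    {q : Fin n → ℝ} {lam : ℝ} (hlam : lam ≠ 0) (hA' : IsUnit (A'ᴴ * A').det)
    (hQ : A' - A = lam • (Q * Matrix.diagonal fun i => (q i : ℂ)))
    (hU : A'ᴴ * (A * S - A' * S') = lam • U) :
    lam⁻¹ • (A * S - A' * S') = A' * (A'ᴴ * A')⁻¹ * U -
      projPerp A' * Q * (Matrix.diagonal fun i => (q i : ℂ)) * S := by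
  have hA : A = A' - lam • (Q * Matrix.diagonal fun i => (q i : ℂ)) := by rw [← hQ]; abel
  have h1 : projPerp A' * (A * S - A' * S') =
      -(lam • (projPerp A' * Q * (Matrix.diagonal fun i => (q i : ℂ)) * S)) := by
    rw [Matrix.mul_sub, ← Matrix.mul_assoc, ← Matrix.mul_assoc, projPerp_mul_self hA', hA,
      Matrix.mul_sub, projPerp_mul_self hA']
    simp [Matrix.mul_assoc]
  have h2 : A * S - A' * S' = A' * (A'ᴴ * A')⁻¹ * (A'ᴴ * (A * S - A' * S')) +
      projPerp A' * (A * S - A' * S') := by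
    rw [projPerp, Matrix.sub_mul, Matrix.one_mul, ← Matrix.mul_assoc (A' * (A'ᴴ * A')⁻¹)]
    abel
  rw [hU, h1] at h2
  rw [h2, smul_add, Matrix.mul_smul, smul_neg, inv_smul_smul₀ hlam, inv_smul_smul₀ hlam,
    ← sub_eq_add_neg]

/-- The linear system for the normalized index displacements `q`. -/
theorem mulVec_eq_of_stationary {B D W : Matrix (Fin m) (Fin n) ℂ}
    {E : Matrix (Fin m) (Fin T) ℂ} {S U : Matrix (Fin n) (Fin T) ℂ} {q : Fin n → ℝ}
    (hE : E = B * U - W * (Matrix.diagonal fun i => (q i : ℂ)) * S)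
    (hst : ∀ i, ((Dᴴ * E * Uᴴ) i i).re = 0) :
    ((Dᴴ * W) ⊙ (S * Uᴴ)ᵀ).map Complex.re *ᵥ q = fun i => ((Dᴴ * B * (U * Uᴴ)) i i).re := by
  funext i
  have h := hst i
  have h1 : Dᴴ * E * Uᴴ = Dᴴ * B * (U * Uᴴ) -
      (Dᴴ * W) * ((Matrix.diagonal fun i => (q i : ℂ)) * (S * Uᴴ)) := by
    rw [hE]
    simp only [Matrix.mul_sub, Matrix.sub_mul, Matrix.mul_assoc]
  rw [h1, Matrix.sub_apply, Complex.sub_re, sub_eq_zero] at h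
  rw [h, Matrix.mul_apply, Complex.re_sum]
  simp only [Matrix.mulVec, dotProduct]
  refine Finset.sum_congr rfl fun j _ => ?_
  rw [Matrix.diagonal_mul, Matrix.map_apply, Matrix.hadamard_apply, Matrix.transpose_apply,
    mul_left_comm, Complex.re_ofReal_mul, mul_comm]

theorem re_stationary_apply {a : ℝ → Fin m → ℂ} {θ : Fin n → ℝ} {S : Matrix (Fin n) (Fin T) ℂ}
    (hS : ∀ i, S i ≠ 0) {R : Matrix (Fin m) (Fin T) ℂ} {i : Fin n} (lam : ℝ)
    (h : reInner (Matrix.vecMulVec (deriv a (θ i)) (S i)) R = 0) :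
    (((derivSteering a θ)ᴴ * (lam⁻¹ • R) * (normalized S)ᴴ) i i).re = 0 := by
  rw [reInner_vecMulVec] at h
  have h1 : ((derivSteering a θ)ᴴ * (lam⁻¹ • R) * (normalized S)ᴴ) i i =
      ((lam⁻¹ * (rowNorm S i)⁻¹ : ℝ) : ℂ) * (star (S i) ⬝ᵥ (star (deriv a (θ i)) ᵥ* R)) := by
    rw [Matrix.mul_smul, Matrix.smul_mul, Matrix.smul_apply, Complex.real_smul, Matrix.mul_apply,
      Complex.ofReal_mul, mul_assoc]
    congr 1
    simp only [dotProduct, Finset.mul_sum]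
    refine Finset.sum_congr rfl fun t _ => ?_
    have h2 : ((derivSteering a θ)ᴴ * R) i t = (star (deriv a (θ i)) ᵥ* R) t := rfl
    rw [h2, Matrix.conjTranspose_apply, normalized_apply hS, star_mul', Pi.star_apply,
      Complex.star_def, Complex.conj_ofReal]
    ring
  rw [h1, Complex.re_ofReal_mul, h, mul_zero]

theorem tendsto_inv {𝕜 ι : Type*} [RCLike 𝕜] {l : Filter ι} {M : ι → Matrix (Fin n) (Fin n) 𝕜}
    {M₀ : Matrix (Fin n) (Fin n) 𝕜} (h : Tendsto M l (𝓝 M₀)) (hM₀ : IsUnit M₀.det) :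
    Tendsto (fun k => (M k)⁻¹) l (𝓝 M₀⁻¹) := by
  refine (continuousAt_matrix_inv M₀ ?_).tendsto.comp h
  rw [Ring.inverse_eq_inv']
  exact continuousAt_inv₀ hM₀.ne_zero

theorem eventually_isUnit_det {𝕜 ι : Type*} [RCLike 𝕜] {l : Filter ι}
    {M : ι → Matrix (Fin n) (Fin n) 𝕜} {M₀ : Matrix (Fin n) (Fin n) 𝕜} (h : Tendsto M l (𝓝 M₀))
    (hM₀ : IsUnit M₀.det) : ∀ᶠ k in l, IsUnit (M k).det := by
  have h1 : Tendsto (fun k => (M k).det) l (𝓝 M₀.det) :=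
    ((continuous_id.matrix_det).tendsto M₀).comp h
  filter_upwards [h1.eventually_ne hM₀.ne_zero] with k hk using hk.isUnit

theorem tendsto_conjTranspose {ι : Type*} {l : Filter ι} {p q : ℕ}
    {M : ι → Matrix (Fin p) (Fin q) ℂ} {M₀ : Matrix (Fin p) (Fin q) ℂ} (h : Tendsto M l (𝓝 M₀)) :
    Tendsto (fun k => (M k)ᴴ) l (𝓝 M₀ᴴ) :=
  ((continuous_id.matrix_conjTranspose).tendsto M₀).comp h

theorem tendsto_normalized {ι : Type*} {l : Filter ι} {Ss : ι → Matrix (Fin n) (Fin T) ℂ}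
    {S : Matrix (Fin n) (Fin T) ℂ} (h : Tendsto Ss l (𝓝 S)) (hs : ∀ k i, Ss k i ≠ 0)
    (hS : ∀ i, S i ≠ 0) : Tendsto (fun k => normalized (Ss k)) l (𝓝 (normalized S)) := by
  refine tendsto_pi_nhds.2 fun i => tendsto_pi_nhds.2 fun t => ?_
  simp only [normalized_apply hS, normalized_apply (hs _)]
  have hrow := tendsto_pi_nhds.1 h i
  have h1 : Tendsto (fun k => rowNorm (Ss k) i) l (𝓝 (rowNorm S i)) :=
    (continuous_l2norm.tendsto (S i)).comp hrow
  exact ((Complex.continuous_ofReal.tendsto _).comp (h1.inv₀ (l2norm_pos (hS i)).ne')).mul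
    (tendsto_pi_nhds.1 hrow t)

theorem ofReal_Gam_mul_normalized {S : Matrix (Fin n) (Fin T) ℂ} (hS : ∀ i, S i ≠ 0) :
    (Matrix.diagonal fun i => (rowNorm S i : ℂ)) * normalized S = S := by
  ext i t
  have hi : rowNorm S i ≠ 0 := (l2norm_pos (hS i)).ne'
  rw [Matrix.diagonal_mul, normalized_apply hS, ← mul_assoc, ← Complex.ofReal_mul,
    mul_inv_cancel₀ hi, Complex.ofReal_one, one_mul]

theorem isUnit_det_Gam {S : Matrix (Fin n) (Fin T) ℂ} (hS : ∀ i, S i ≠ 0) :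
    IsUnit (Gam S).det := by
  rw [Gam, Matrix.det_diagonal]
  exact (Finset.prod_ne_zero_iff.2 fun i _ => (l2norm_pos (hS i)).ne').isUnit

/-- Writing `S = Γ_S U` scales row `j` of `U Uᴴ`, which is column `j` after transposition. This is
the source of the factor `Γ_S⁻¹` in `beta`. -/
theorem map_re_hadamard_eq_Rmat_mul_Gam (a : ℝ → Fin m → ℂ) (θ : Fin n → ℝ)
    {S : Matrix (Fin n) (Fin T) ℂ} (hS : ∀ i, S i ≠ 0) :
    (((derivSteering a θ)ᴴ * (projPerp (steering a θ) * derivSteering a θ)) ⊙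
      (S * (normalized S)ᴴ)ᵀ).map Complex.re = Rmat a θ S * Gam S := by
  ext i j
  have h1 : (S * (normalized S)ᴴ) j i = (rowNorm S j : ℂ) * Xi S j i := by
    rw [← Matrix.diagonal_mul (fun i => (rowNorm S i : ℂ)), Xi, ← Matrix.mul_assoc,
      ofReal_Gam_mul_normalized hS]
  rw [Gam, Matrix.mul_diagonal, Rmat, Matrix.map_apply, Matrix.map_apply, Matrix.hadamard_apply,
    Matrix.hadamard_apply, Matrix.transpose_apply, Matrix.transpose_apply, h1, Matrix.mul_assoc,
    mul_left_comm, Complex.re_ofReal_mul, mul_comm]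

theorem biasVec_eq (a : ℝ → Fin m → ℂ) (θ : Fin n → ℝ) (S : Matrix (Fin n) (Fin T) ℂ) :
    biasVec a θ S = fun i => (((derivSteering a θ)ᴴ *
      (steering a θ * ((steering a θ)ᴴ * steering a θ)⁻¹) *
        (normalized S * (normalized S)ᴴ)) i i).re := by
  funext i
  rw [Matrix.mul_assoc]
  rfl

theorem beta_eq (a : ℝ → Fin m → ℂ) (θ : Fin n → ℝ) (S : Matrix (Fin n) (Fin T) ℂ) :
    beta a θ S = (Rmat a θ S * Gam S)⁻¹ *ᵥ biasVec a θ S := by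
  rw [beta, Matrix.mul_inv_rev, Matrix.mulVec_mulVec]

theorem deltaQ0_mul_normalized (a : ℝ → Fin m → ℂ) (θ : Fin n → ℝ)
    {S : Matrix (Fin n) (Fin T) ℂ} (hS : ∀ i, S i ≠ 0) :
    deltaQ0 a θ S * normalized S = (Matrix.diagonal fun i => (beta a θ S i : ℂ)) * S := by
  conv_rhs => enter [2]; rw [← ofReal_Gam_mul_normalized hS]
  rw [← Matrix.mul_assoc, Matrix.diagonal_mul_diagonal, deltaQ0]
  congr 2
  funext i
  rw [Gam, Matrix.mulVec_diagonal, Complex.ofReal_mul, mul_comm]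

/-- Along a sequence of solutions that converges to the true parameters, the residual divided by
the regularization parameter has an explicit limit. -/
theorem tendsto_residual {a : ℝ → Fin m → ℂ} {Θ : Set ℝ} (ha : ContDiffOn ℝ ∞ a Θ)
    {θ : Fin n → ℝ} {S : Matrix (Fin n) (Fin T) ℂ} (hint : ∀ i, θ i ∈ interior Θ)
    (hA : IsUnit ((steering a θ)ᴴ * steering a θ).det) (hR : IsUnit (Rmat a θ S).det)
    (hS : ∀ i, S i ≠ 0) {lam : ℕ → ℝ} {θs : ℕ → Fin n → ℝ}
    {Ss : ℕ → Matrix (Fin n) (Fin T) ℂ} (hlam : ∀ k, 0 < lam k)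
    (hsol : ∀ k, IsSolution a Θ (steering a θ * S) (lam k) (θs k) (Ss k))
    (hθs : Tendsto θs atTop (𝓝 θ)) (hSs : Tendsto Ss atTop (𝓝 S)) :
    Tendsto (fun k => (lam k)⁻¹ • (steering a θ * S - steering a (θs k) * Ss k)) atTop
      (𝓝 (steering a θ * ((steering a θ)ᴴ * steering a θ)⁻¹ * normalized S -
        projPerp (steering a θ) * derivSteering a θ *
          (Matrix.diagonal fun i => (beta a θ S i : ℂ)) * S)) := by
  have hcd : ∀ x ∈ interior Θ, ContDiffAt ℝ ∞ a x := fun x hx =>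
    ha.contDiffAt (mem_interior_iff_mem_nhds.1 hx)
  have hdiff : ∀ x ∈ interior Θ, DifferentiableAt ℝ a x := fun x hx =>
    (hcd x hx).differentiableAt (by simp)
  have hθi : ∀ i, Tendsto (fun k => θs k i) atTop (𝓝 (θ i)) := tendsto_pi_nhds.1 hθs
  have hlA : Tendsto (fun k => steering a (θs k)) atTop (𝓝 (steering a θ)) :=
    tendsto_steering fun i => (hdiff _ (hint i)).continuousAt.tendsto.comp (hθi i)
  have hderiv : ∀ x ∈ interior Θ, ContinuousAt (deriv a) x := fun x hx =>
    (((ha.mono interior_subset).continuousOn_deriv_of_isOpen isOpen_interior (by simp)).continuousAt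
      (isOpen_interior.mem_nhds hx))
  have hlD : Tendsto (fun k => derivSteering a (θs k)) atTop (𝓝 (derivSteering a θ)) :=
    tendsto_steering fun i => (hderiv _ (hint i)).tendsto.comp (hθi i)
  let Q : ℕ → Matrix (Fin m) (Fin n) ℂ := fun k =>
    Matrix.of fun r i => dslope a (θ i) (θs k i) r
  let q : ℕ → Fin n → ℝ := fun k i => (lam k)⁻¹ * (θs k i - θ i)
  have hlQ : Tendsto Q atTop (𝓝 (derivSteering a θ)) := by
    refine tendsto_pi_nhds.2 fun r => tendsto_pi_nhds.2 fun i => ?_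
    have h1 : Tendsto (fun k => dslope a (θ i) (θs k i)) atTop (𝓝 (dslope a (θ i) (θ i))) :=
      (continuousAt_dslope_same.2 (hdiff _ (hint i))).tendsto.comp (hθi i)
    rw [dslope_same] at h1
    exact tendsto_pi_nhds.1 h1 r
  have hQ : ∀ k, steering a (θs k) - steering a θ =
      lam k • (Q k * Matrix.diagonal fun i => (q k i : ℂ)) := by
    intro k
    ext r i
    have h1 := congrFun (sub_smul_dslope a (θ i) (θs k i)) r
    rw [Pi.sub_apply, Pi.smul_apply, Complex.real_smul] at h1
    have h2 : lam k * q k i = θs k i - θ i := mul_inv_cancel_left₀ (hlam k).ne' _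
    rw [Matrix.smul_apply, Matrix.mul_diagonal, Complex.real_smul, mul_left_comm,
      ← Complex.ofReal_mul, h2, mul_comm]
    exact h1.symm
  have hlU := tendsto_normalized hSs (fun k => (hsol k).1.2.2) hS
  have hlG := tendsto_mul (tendsto_conjTranspose hlA) hlA
  have hlB := tendsto_mul hlA (tendsto_inv hlG hA)
  have hlP : Tendsto (fun k => projPerp (steering a (θs k))) atTop (𝓝 (projPerp (steering a θ))) :=
    tendsto_const_nhds.sub (tendsto_mul hlB (tendsto_conjTranspose hlA))
  have hlW := tendsto_mul hlP hlQ
  have hres : ∀ᶠ k in atTop, (lam k)⁻¹ • (steering a θ * S - steering a (θs k) * Ss k) =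
      steering a (θs k) * ((steering a (θs k))ᴴ * steering a (θs k))⁻¹ * normalized (Ss k) -
        projPerp (steering a (θs k)) * Q k * (Matrix.diagonal fun i => (q k i : ℂ)) * S := by
    filter_upwards [eventually_isUnit_det hlG hA] with k hk
    exact residual_eq (hlam k).ne' hk (hQ k) ((hsol k).conjTranspose_mul_residual (hlam k).le)
  let N : ℕ → Matrix (Fin n) (Fin n) ℝ := fun k =>
    (((derivSteering a (θs k))ᴴ * (projPerp (steering a (θs k)) * Q k)) ⊙
      (S * (normalized (Ss k))ᴴ)ᵀ).map Complex.re
  let b : ℕ → Fin n → ℝ := fun k i => (((derivSteering a (θs k))ᴴ *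
      (steering a (θs k) * ((steering a (θs k))ᴴ * steering a (θs k))⁻¹) *
        (normalized (Ss k) * (normalized (Ss k))ᴴ)) i i).re
  have hlN : Tendsto N atTop (𝓝 (Rmat a θ S * Gam S)) := by
    rw [← map_re_hadamard_eq_Rmat_mul_Gam a θ hS]
    refine tendsto_pi_nhds.2 fun i => tendsto_pi_nhds.2 fun j => ?_
    have h1 := tendsto_mul (tendsto_conjTranspose hlD) hlW
    have h2 := tendsto_mul (tendsto_const_nhds (x := S)) (tendsto_conjTranspose hlU)
    exact (Complex.continuous_re.tendsto _).comp
      ((tendsto_pi_nhds.1 (tendsto_pi_nhds.1 h1 i) j).mul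
        (tendsto_pi_nhds.1 (tendsto_pi_nhds.1 h2 j) i))
  have hlb : Tendsto b atTop (𝓝 (biasVec a θ S)) := by
    rw [biasVec_eq]
    refine tendsto_pi_nhds.2 fun i => ?_
    have h1 := tendsto_mul (tendsto_mul (tendsto_conjTranspose hlD) hlB)
      (tendsto_mul hlU (tendsto_conjTranspose hlU))
    exact (Complex.continuous_re.tendsto _).comp (tendsto_pi_nhds.1 (tendsto_pi_nhds.1 h1 i) i)
  have hRG : IsUnit (Rmat a θ S * Gam S).det := by
    rw [Matrix.det_mul]
    exact hR.mul (isUnit_det_Gam hS)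
  have hintk : ∀ᶠ k in atTop, ∀ i, θs k i ∈ interior Θ :=
    eventually_all.2 fun i => (hθi i).eventually (isOpen_interior.mem_nhds (hint i))
  have hq : ∀ᶠ k in atTop, (N k)⁻¹ *ᵥ b k = q k := by
    filter_upwards [hres, hintk, eventually_isUnit_det hlN hRG] with k hk hik huk
    have h1 : N k *ᵥ q k = b k := mulVec_eq_of_stationary hk fun i =>
      re_stationary_apply (hsol k).1.2.2 _
        ((hsol k).re_deriv_eq_zero (hlam k).le (hik i) (hdiff _ (hik i)))
    rw [← h1, Matrix.mulVec_mulVec, Matrix.nonsing_inv_mul _ huk, Matrix.one_mulVec]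
  have hlq : Tendsto q atTop (𝓝 (beta a θ S)) := by
    rw [beta_eq]
    refine Tendsto.congr' hq (tendsto_pi_nhds.2 fun i => ?_)
    exact tendsto_finsetSum Finset.univ fun j _ =>
      (tendsto_pi_nhds.1 (tendsto_pi_nhds.1 (tendsto_inv hlN hRG) i) j).mul
        (tendsto_pi_nhds.1 hlb j)
  have hlΔ : Tendsto (fun k => Matrix.diagonal fun i => (q k i : ℂ)) atTop
      (𝓝 (Matrix.diagonal fun i => (beta a θ S i : ℂ))) := by
    refine ((Continuous.matrix_diagonal continuous_id).tendsto _).comp (tendsto_pi_nhds.2 fun i => ?_)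
    exact (Complex.continuous_ofReal.tendsto _).comp (tendsto_pi_nhds.1 hlq i)
  exact Tendsto.congr' (hres.mono fun k hk => hk.symm)
    ((tendsto_mul hlB hlU).sub (tendsto_mul (tendsto_mul hlW hlΔ) tendsto_const_nhds))

theorem l2norm_vecMul_sq {p : ℕ} (v : Fin n → ℂ) (W : Matrix (Fin n) (Fin p) ℂ) :
    l2norm (v ᵥ* W) ^ 2 = ((v ᵥ* (W * Wᴴ)) ⬝ᵥ star v).re := by
  rw [← re_star_dotProduct_self, dotProduct_comm, ← Matrix.vecMul_vecMul, Matrix.star_vecMul,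
    Matrix.dotProduct_mulVec]

end CLASS

end

open CLASS

theorem proposition2 {m n T : ℕ} (Θ : Set ℝ) (hΘ : IsClosed Θ)
    (a : ℝ → Fin m → ℂ) (ha : ContDiffOn ℝ ∞ a Θ)
    (θ : Fin n → ℝ) (S : Matrix (Fin n) (Fin T) ℂ)
    (hint : ∀ i, θ i ∈ interior Θ)
    (hA : IsUnit ((CLASS.steering a θ)ᴴ * CLASS.steering a θ).det)
    (hR : IsUnit (CLASS.Rmat a θ S).det)
    (hcons : CLASS.IsConsistent a Θ θ S)
    (hpure : CLASS.IsPure a Θ θ S)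
    (Ξhalf : Matrix (Fin n) (Fin n) ℂ) (hΞ : Ξhalf * Ξhalfᴴ = CLASS.Xi S) :
    ∀ ϑ ∈ Θ,
      CLASS.l2norm (star (a ϑ) ᵥ*
        ((CLASS.projPerp (CLASS.steering a θ) * CLASS.derivSteering a θ * CLASS.deltaQ0 a θ S
            - CLASS.steering a θ * ((CLASS.steering a θ)ᴴ * CLASS.steering a θ)⁻¹) * Ξhalf)) ≤ 1 := by
  intro ϑ hϑ
  have hS : ∀ i, S i ≠ 0 := hcons.1.1.2.2
  obtain ⟨lam, θs, Ss, hlam, hsol, hθs, hSs⟩ := exists_seq_solutions hΘ ha.continuousOn hcons hpure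
  have hlim := tendsto_residual ha hint hA hR hS hlam hsol hθs hSs
  set M := projPerp (steering a θ) * derivSteering a θ * deltaQ0 a θ S
    - steering a θ * ((steering a θ)ᴴ * steering a θ)⁻¹ with hM
  have hE : steering a θ * ((steering a θ)ᴴ * steering a θ)⁻¹ * normalized S -
      projPerp (steering a θ) * derivSteering a θ *
        (Matrix.diagonal fun i => (beta a θ S i : ℂ)) * S = (-1 : ℝ) • (M * normalized S) := by
    rw [hM, Matrix.sub_mul, Matrix.mul_assoc _ (deltaQ0 a θ S), deltaQ0_mul_normalized a θ hS,
      ← Matrix.mul_assoc, neg_one_smul, neg_sub]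
  rw [hE] at hlim
  have hbound : ∀ k, l2norm (star (a ϑ) ᵥ*
      ((lam k)⁻¹ • (steering a θ * S - steering a (θs k) * Ss k))) ≤ 1 := by
    intro k
    rw [Matrix.vecMul_smul, l2norm_smul, abs_of_pos (inv_pos.2 (hlam k)), inv_mul_le_one₀ (hlam k)]
    exact (hsol k).l2norm_vecMul_le (hlam k).le hϑ
  have hcont : Continuous fun E : Matrix (Fin m) (Fin T) ℂ => l2norm (star (a ϑ) ᵥ* E) :=
    continuous_l2norm.comp (continuous_const.matrix_vecMul continuous_id)
  have hU : l2norm (star (a ϑ) ᵥ* (M * normalized S)) ≤ 1 := by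
    have h1 := le_of_tendsto ((hcont.tendsto _).comp hlim) (Eventually.of_forall hbound)
    rwa [Matrix.vecMul_smul, l2norm_smul, abs_neg, abs_one, one_mul] at h1
  have hsq : l2norm (star (a ϑ) ᵥ* (M * Ξhalf)) ^ 2 =
      l2norm (star (a ϑ) ᵥ* (M * normalized S)) ^ 2 := by
    rw [← Matrix.vecMul_vecMul, ← Matrix.vecMul_vecMul, l2norm_vecMul_sq, l2norm_vecMul_sq, hΞ, Xi]
  rw [pow_left_inj₀ (l2norm_nonneg _) (l2norm_nonneg _) two_ne_zero] at hsq
  exact hsq.trans_le hU
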